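/- Let $(X,d)$ be a proper, non-compact $\mathrm{CAT}(-1)$ space and let $\Gamma$ be a group of isometries of $X$ that acts properly discontinuously and cocompactly on $X$. Equip $X\times X$ with the metric $d_{\max}((x,y),(x',y'))=\max\{d(x,x'),d(y,y')\}$ and with the diagonal action of $\Gamma$. Let $C_*$ be the space of continuous real functions on $X\times X$, with the topology of uniform convergence on compact sets, modulo additive constants; let $\iota:X\times X\to C_*$ send $P$ to the class of $d_{\max}(P,\cdot)$, and let $\partial_\infty^{\max}(X\times X)=\overline{\iota(X\times X)}\setminus\iota(X\times X)$ be the horofunction boundary. The group $\Gamma$ acts on $C_*$ by $\gamma[h]=[h\circ\gamma^{-1}]$, which extends its action on $X\times X$. For an ideal point $\xi\in\partial_\infty X$ (a class of asymptotic geodesic rays) and a geodesic ray $c$ with $c(0)=p$ and $c(\infty)=\xi$, let $\beta^p_\xi(z)=\lim_{t\to\infty}(d(z,c(t))-t)$. Let $\Omega\subset\partial_\infty^{\max}(X\times X)$, with the subspace topology, be the set of the boundary points that are the class of a function $(z,z')\mapsto\max\{\beta^{p}_{\xi}(z),\beta^{p'}_{\xi'}(z')\}$ with $p,p'\in X$ and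 $\xi\ne\xi'$ in $\partial_\infty X$. Let $G$ be the set of parametrized geodesics of $X$, that is, of isometric embeddings $g:\mathbb{R}\to X$, with the topology of uniform convergence on compact sets, on which $\Gamma$ acts by $\gamma g=\gamma\circ g$. Then $\Omega$ is $\Gamma$-invariant, for every $g\in G$ the limit $\lim_{n\to\infty}\iota(g(n),g(-n))$ in the horofunction compactification $\overline{\iota(X\times X)}$ exists and belongs to $\Omega$, and the map $$f:G\to\Omega,\qquad g\mapsto\lim_{n\to\infty}(g(n),g(-n)),$$ is a $\Gamma$-equivariant homeomorphism. -/

import Mathlib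

open Filter Topology
open scoped NNReal

namespace MaxHoro

section Isometries

/-- The (paths of) geodesic segments from `x` to `y`, parametrized by arc length on
`[0, d(x, y)]`; the values of `c` off that interval play no role. -/
def IsGeodesicSegment {X : Type*} [MetricSpace X] (c : ℝ → X) (x y : X) : Prop :=
  c 0 = x ∧ c (dist x y) = y ∧
    ∀ s ∈ Set.Icc 0 (dist x y), ∀ t ∈ Set.Icc 0 (dist x y), dist (c s) (c t) = |s - t|

/-- Any two points are joined by a geodesic segment. -/
def IsGeodesicSpace (X : Type*) [MetricSpace X] : Prop :=
  ∀ x y : X, ∃ c : ℝ → X, IsGeodesicSegment c x y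

/-- `p'` is the comparison point, on the side `[x', y']` of a comparison triangle in the
hyperbolic plane, of the point at distance `s` from `x` on a side `[x, y]` of length `l`. -/
def IsComparisonPoint (x' y' p' : UpperHalfPlane) (s l : ℝ) : Prop :=
  dist x' p' = s ∧ dist p' y' = l - s

/-- `CAT(-1)` spaces: geodesic spaces in which every geodesic triangle is at least as thin as its
comparison triangle `x' y' z'` in the hyperbolic plane. Two points on distinct sides are always, up
to naming the vertices, on the sides `[x, y]` and `[x, z]`; on a single side the inequality is
trivial. -/
structure IsCATNegOne (X : Type*) [MetricSpace X] : Prop where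
  geodesic : IsGeodesicSpace X
  comparison : ∀ (x y z : X) (c₁ c₂ c₃ : ℝ → X),
    IsGeodesicSegment c₁ x y → IsGeodesicSegment c₂ x z → IsGeodesicSegment c₃ y z →
    ∀ x' y' z' : UpperHalfPlane,
      dist x' y' = dist x y → dist x' z' = dist x z → dist y' z' = dist y z →
      ∀ s ∈ Set.Icc 0 (dist x y), ∀ t ∈ Set.Icc 0 (dist x z), ∀ p' q' : UpperHalfPlane,
        IsComparisonPoint x' y' p' s (dist x y) → IsComparisonPoint x' z' q' t (dist x z) →
        dist (c₁ s) (c₂ t) ≤ dist p' q'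

/-- The action of a group of isometries is properly discontinuous: each compact set meets only
finitely many of its translates. -/
def IsProperlyDiscontinuous {X : Type*} [MetricSpace X] (Γ : Subgroup (X ≃ᵢ X)) : Prop :=
  ∀ K : Set X, IsCompact K → {γ : X ≃ᵢ X | γ ∈ Γ ∧ (K ∩ γ '' K).Nonempty}.Finite

/-- The translates of some compact set cover the space. -/
def IsCocompact {X : Type*} [MetricSpace X] (Γ : Subgroup (X ≃ᵢ X)) : Prop :=
  ∃ K : Set X, IsCompact K ∧ ⋃ γ ∈ Γ, γ '' K = Set.univ

/-- The diagonal action of an isometry of `X` on `X × X`. The distance of Mathlib on a product is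
the maximum distance. -/
def diag {X : Type*} [MetricSpace X] (γ : X ≃ᵢ X) : (X × X) ≃ᵢ (X × X) where
  toEquiv := Equiv.prodCongr γ.toEquiv γ.toEquiv
  isometry_toFun := γ.isometry.prodMap γ.isometry

theorem dist_prod_eq_max {X : Type*} [MetricSpace X] (x y x' y' : X) :
    dist (x, y) (x', y') = max (dist x x') (dist y y') := rfl

/-- The parametrized geodesics of `X`, with the compact-open topology, which is the topology of
uniform convergence on compact sets. -/
abbrev Geodesic (X : Type*) [MetricSpace X] : Type _ := {g : C(ℝ, X) // Isometry g}

/-- The action of isometries on geodesics, `γ g = γ ∘ g`. -/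
def Geodesic.translate {X : Type*} [MetricSpace X] (γ : X ≃ᵢ X) (g : Geodesic X) : Geodesic X :=
  ⟨⟨fun t => γ (g.1 t), γ.continuous.comp g.1.continuous⟩, γ.isometry.comp g.2⟩

end Isometries

section Compactification

/-- The constant functions on `Y`. -/
def constants (Y : Type*) [MetricSpace Y] : AddSubgroup C(Y, ℝ) where
  carrier := Set.range (ContinuousMap.const Y)
  zero_mem' := ⟨0, rfl⟩
  add_mem' := by
    rintro _ _ ⟨a, rfl⟩ ⟨b, rfl⟩
    exact ⟨a + b, rfl⟩
  neg_mem' := by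
    rintro _ ⟨a, rfl⟩
    exact ⟨-a, rfl⟩

/-- The space `C_*` of continuous functions on `Y` modulo additive constants, with the quotient of
the topology of uniform convergence on compact sets. -/
abbrev CStar (Y : Type*) [MetricSpace Y] : Type _ := C(Y, ℝ) ⧸ constants Y

/-- The class of a continuous function modulo constants. -/
def cls {Y : Type*} [MetricSpace Y] (h : C(Y, ℝ)) : CStar Y := QuotientAddGroup.mk h

/-- The map `ι : Y → C_*`, sending a point to the class of the distance to it. -/
def iota {Y : Type*} [MetricSpace Y] (y : Y) : CStar Y :=
  cls ⟨fun z => dist y z, by fun_prop⟩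

/-- The horofunction compactification of `Y`, as a subset of `C_*`. -/
def compactification (Y : Type*) [MetricSpace Y] : Set (CStar Y) := closure (Set.range iota)

/-- The horofunction boundary of `Y`. -/
def horoBoundary (Y : Type*) [MetricSpace Y] : Set (CStar Y) :=
  compactification Y \ Set.range iota

theorem isClosed_constants (Y : Type*) [MetricSpace Y] :
    IsClosed (constants Y : Set C(Y, ℝ)) := by
  have h : (constants Y : Set C(Y, ℝ)) = ⋂ (x : Y) (y : Y), {f : C(Y, ℝ) | f x = f y} := by
    ext f
    simp only [Set.mem_iInter, Set.mem_ofPred_eq]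
    constructor
    · rintro ⟨a, rfl⟩ x y
      rfl
    · intro h
      rcases isEmpty_or_nonempty Y with hY | ⟨⟨y⟩⟩
      · exact ⟨0, ContinuousMap.ext fun x => (hY.false x).elim⟩
      · exact ⟨f y, ContinuousMap.ext fun x => h y x⟩
  rw [h]
  exact isClosed_iInter fun x => isClosed_iInter fun y =>
    isClosed_eq (by fun_prop) (by fun_prop)

/-- Limits in `C_*` are unique. -/
instance instT2SpaceCStar (Y : Type*) [MetricSpace Y] : T2Space (CStar Y) := by
  have := isClosed_constants Y
  infer_instance

/-- The action of an isometry `e` of `Y` on `C_*`, `[h] ↦ [h ∘ e⁻¹]`. -/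
def act {Y : Type*} [MetricSpace Y] (e : Y ≃ᵢ Y) : CStar Y → CStar Y :=
  Quotient.map' (fun h : C(Y, ℝ) => ⟨fun y => h (e.symm y), by fun_prop⟩) (by
    intro a b hab
    rw [QuotientAddGroup.leftRel_apply] at hab ⊢
    obtain ⟨r, hr⟩ := hab
    exact ⟨r, ContinuousMap.ext fun y => DFunLike.congr_fun hr (e.symm y)⟩)

/-- The action on `C_*` extends the action on `Y`. -/
theorem act_iota {Y : Type*} [MetricSpace Y] (e : Y ≃ᵢ Y) (y : Y) :
    act e (iota y) = iota (e y) := by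
  refine congrArg cls (ContinuousMap.ext fun z => ?_)
  change dist y (e.symm z) = dist (e y) z
  rw [← e.dist_eq, e.apply_symm_apply]

/-- The action on `C_*` is continuous, hence on the closure of `Y` it is the only continuous
extension of the action on `Y`. -/
theorem continuous_act {Y : Type*} [MetricSpace Y] (e : Y ≃ᵢ Y) : Continuous (act e) := by
  refine Continuous.quotient_map' ?_ _
  exact ContinuousMap.continuous_precomp (⟨e.symm, e.symm.continuous⟩ : C(Y, Y))

end Compactification

section Rays

/-- Geodesic rays. -/
abbrev Ray (X : Type*) [MetricSpace X] : Type _ := {c : ℝ≥0 → X // Isometry c}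

/-- Two rays are asymptotic if they stay at bounded distance from each other. -/
def asymptotic (X : Type*) [MetricSpace X] : Setoid (Ray X) where
  r c c' := ∃ C : ℝ, ∀ t, dist (c.1 t) (c'.1 t) ≤ C
  iseqv := by
    refine ⟨fun c => ⟨0, fun t => by simp⟩, ?_, ?_⟩
    · rintro c c' ⟨C, h⟩
      exact ⟨C, fun t => by rw [dist_comm]; exact h t⟩
    · rintro c c' c'' ⟨C, h⟩ ⟨C', h'⟩
      exact ⟨C + C', fun t => (dist_triangle _ (c'.1 t) _).trans (add_le_add (h t) (h' t))⟩

/-- The ideal boundary of `X` by rays, as a set. -/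
def IdealBoundary (X : Type*) [MetricSpace X] : Type _ := Quotient (asymptotic X)

/-- The ideal endpoint `c(∞)` of a ray. -/
def Ray.endpoint {X : Type*} [MetricSpace X] (c : Ray X) : IdealBoundary X :=
  Quotient.mk (asymptotic X) c

/-- The Busemann function `β^p_ξ` with `p = c(0)` and `ξ = c(∞)`:
`y ↦ lim_{t → ∞} d(y, c(t)) - t`. -/
noncomputable def busemannFun {X : Type*} [MetricSpace X] (c : Ray X) (y : X) : ℝ :=
  limUnder atTop (fun t : ℝ≥0 => dist y (c.1 t) - t)

/-- The limit that defines a Busemann function exists. -/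
theorem tendsto_busemannFun {X : Type*} [MetricSpace X] (c : Ray X) (y : X) :
    Tendsto (fun t : ℝ≥0 => dist y (c.1 t) - t) atTop (𝓝 (busemannFun c y)) := by
  have hd : ∀ s t : ℝ≥0, s ≤ t → dist (c.1 s) (c.1 t) = t - s := by
    intro s t hst
    rw [c.2.dist_eq, NNReal.dist_eq, abs_sub_comm, abs_of_nonneg]
    exact sub_nonneg.mpr (NNReal.coe_le_coe.mpr hst)
  refine tendsto_nhds_limUnder ⟨_, tendsto_atTop_ciInf ?_ ?_⟩
  · intro s t hst
    have h1 := dist_triangle y (c.1 s) (c.1 t)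
    have h2 := hd s t hst
    change dist y (c.1 t) - t ≤ dist y (c.1 s) - s
    linarith
  · refine ⟨-dist y (c.1 0), ?_⟩
    rintro _ ⟨t, rfl⟩
    have h1 := dist_triangle (c.1 0) y (c.1 t)
    have h2 := hd 0 t zero_le
    have h3 := dist_comm y (c.1 0)
    have h4 : ((0 : ℝ≥0) : ℝ) = 0 := rfl
    change -dist y (c.1 0) ≤ dist y (c.1 t) - t
    linarith

theorem busemannFun_sub_le {X : Type*} [MetricSpace X] (c : Ray X) (y z : X) :
    busemannFun c y - busemannFun c z ≤ dist y z := by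
  refine le_of_tendsto ((tendsto_busemannFun c y).sub (tendsto_busemannFun c z))
    (Eventually.of_forall fun t => ?_)
  have := dist_triangle y z (c.1 t)
  linarith

theorem continuous_busemannFun {X : Type*} [MetricSpace X] (c : Ray X) :
    Continuous (busemannFun c) := by
  refine (LipschitzWith.of_dist_le_mul (K := 1) fun y z => ?_).continuous
  rw [Real.dist_eq, NNReal.coe_one, one_mul, abs_le]
  have h1 := busemannFun_sub_le c y z
  have h2 := busemannFun_sub_le c z y
  rw [dist_comm z y] at h2
  constructor <;> linarith

/-- The function `(z, z') ↦ max (β^p_ξ(z), β^{p'}_{ξ'}(z'))` on `X × X`, with `p, ξ` the origin and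
endpoint of `c` and `p', ξ'` those of `c'`. -/
noncomputable def maxBusemann {X : Type*} [MetricSpace X] (c c' : Ray X) : C(X × X, ℝ) :=
  ⟨fun w => max (busemannFun c w.1) (busemannFun c' w.2),
    ((continuous_busemannFun c).comp continuous_fst).max
      ((continuous_busemannFun c').comp continuous_snd)⟩

/-- The ideal domain `Ω`: the points of the regular part of the horofunction boundary of `X × X`
for the maximum metric, that is the classes of `max (β^p_ξ(z), β^{p'}_{ξ'}(z'))`, for which
`ξ ≠ ξ'`. -/
def idealDomain (X : Type*) [MetricSpace X] : Set (CStar (X × X)) :=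
  {F | F ∈ horoBoundary (X × X) ∧
    ∃ c c' : Ray X, c.endpoint ≠ c'.endpoint ∧ F = cls (maxBusemann c c')}

end Rays

end MaxHoro

/-! The boundary point of a geodesic `g` is the class of the maximum of the Busemann functions b₊,
b₋ of its two rays, both based at `g 0`. Everything metric flows from Stewart's inequality
`IsCATNegOne.sinh_mul_cosh_dist_le`. Multiplied by 2e^{-s} and taken to the limit as vertices go to
infinity, it bounds distances by exponentials of Busemann functions. In particular
`IsCATNegOne.cosh_dist_geodesic_le` says that a point where b₊ is near -r and b₋ near r is close to
`g r`.

Surjectivity is visibility (`IsCATNegOne.exists_geodesic`): segments between two non-asymptotic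
rays, parametrized from their midpoints, have a limit geodesic. Since midpoints are used, its two
Busemann functions differ from the given ones by the same constant, which the maximum turns into an
additive constant and the quotient forgets.

Continuity holds because a Busemann function is approximated by distances along its ray with an
error of order e^{-2t} (`IsCATNegOne.exp_dist_ray_sub_le`). Injectivity and continuity of the
inverse both come from `IsCATNegOne.tendsto_of_tendsto_boundaryPoint`. Convergence of the maxima
modulo constants first separates the two Busemann functions (`tendsto_of_tendsto_max`); the lost
additive constant is then recovered from a shadow point, and the geodesics converge by the distance
bound above. -/

namespace MaxHoro

/-! ### Hyperbolic comparison triangles and Stewart's inequality. -/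

section Comparison

/-- A hyperbolic triangle with prescribed side lengths, together with the points of one of its
sides and their distances to the opposite vertex. -/
theorem exists_comparison_triangle {l a b : ℝ} (hl : 0 < l) (ha : 0 ≤ a) (hb : 0 ≤ b)
    (h₁ : b ≤ a + l) (h₂ : |a - l| ≤ b) :
    ∃ x y z : UpperHalfPlane, dist x y = l ∧ dist x z = a ∧ dist y z = b ∧
      ∀ s ∈ Set.Icc 0 l, ∃ p : UpperHalfPlane, IsComparisonPoint x y p s l ∧
        Real.sinh l * Real.cosh (dist p z) =
          Real.sinh (l - s) * Real.cosh a + Real.sinh s * Real.cosh b := by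
  have hsl : 0 < Real.sinh l := Real.sinh_pos_iff.mpr hl
  have hup : Real.cosh b ≤ Real.cosh (a + l) := by
    rw [Real.cosh_le_cosh, abs_of_nonneg hb, abs_of_nonneg (by linarith)]
    exact h₁
  have hlow : Real.cosh (a - l) ≤ Real.cosh b := by
    rw [Real.cosh_le_cosh, abs_of_nonneg hb]
    exact h₂
  have hprod := mul_nonneg (sub_nonneg.mpr hup) (sub_nonneg.mpr hlow)
  have hca : Real.sinh a < Real.cosh a := Real.sinh_lt_cosh a
  have hel : Real.exp l = Real.cosh l + Real.sinh l := (Real.cosh_add_sinh l).symm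
  have hel' : Real.exp (-l) = Real.cosh l - Real.sinh l := (Real.cosh_sub_sinh l).symm
  have hsq := Real.cosh_sq' l
  have hsqa := Real.cosh_sq' a
  rw [Real.cosh_add] at hup
  rw [Real.cosh_sub] at hlow
  rw [Real.cosh_add, Real.cosh_sub] at hprod
  have hlt := mul_lt_mul_of_pos_right hca hsl
  -- With the side on the imaginary axis at ie^s, the distance to z = u + iv satisfies cosh =
  -- Ae^{-s} + Be^s, where A = (u² + v²)/(2v) and B = 1/(2v). These values solve the equations at s
  -- = 0 and s = l.
  obtain ⟨A, hA⟩ : ∃ A, A = (Real.exp l * Real.cosh a - Real.cosh b) / (2 * Real.sinh l) := ⟨_, rfl⟩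
  obtain ⟨B, hB⟩ : ∃ B, B = (Real.cosh b - Real.exp (-l) * Real.cosh a) / (2 * Real.sinh l) :=
    ⟨_, rfl⟩
  have hBpos : 0 < B := by
    rw [hB, hel']
    apply div_pos <;> nlinarith
  -- This is u² ≥ 0. It amounts to (cosh(a + l) - cosh b)(cosh b - cosh(a - l)) ≥ 0, that is, to the
  -- triangle inequalities.
  have hAB : 1 ≤ 4 * (A * B) := by
    rw [hA, hB, hel, hel', div_mul_div_comm, ← mul_div_assoc, le_div_iff₀ (by positivity)]
    nlinarith
  have hsum : A + B = Real.cosh a := by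
    rw [hA, hB, hel, hel']
    field_simp
    ring
  have hsum' : A * Real.exp (-l) + B * Real.exp l = Real.cosh b := by
    rw [hA, hB, hel, hel']
    field_simp
    ring
  let V : ℝ → UpperHalfPlane := fun s => ⟨⟨0, Real.exp s⟩, Real.exp_pos s⟩
  have hV : ∀ s t, dist (V s) (V t) = |s - t| := by
    intro s t
    rw [UpperHalfPlane.dist_of_re_eq (by rfl)]
    change dist (Real.log (Real.exp s)) (Real.log (Real.exp t)) = _
    rw [Real.log_exp, Real.log_exp, Real.dist_eq]
  have hvpos : 0 < 1 / (2 * B) := by positivity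
  let z : UpperHalfPlane := ⟨⟨Real.sqrt (A / B - (1 / (2 * B)) ^ 2), 1 / (2 * B)⟩, hvpos⟩
  have hsqrt : Real.sqrt (A / B - (1 / (2 * B)) ^ 2) ^ 2 = A / B - (1 / (2 * B)) ^ 2 := by
    apply Real.sq_sqrt
    have : A / B - (1 / (2 * B)) ^ 2 = (4 * (A * B) - 1) / (4 * B ^ 2) := by
      field_simp
      ring
    rw [this]
    exact div_nonneg (by linarith) (by positivity)
  have hz : ∀ s, Real.cosh (dist (V s) z) = A * Real.exp (-s) + B * Real.exp s := by
    intro s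
    rw [UpperHalfPlane.cosh_dist']
    change ((0 - Real.sqrt (A / B - (1 / (2 * B)) ^ 2)) ^ 2 + Real.exp s ^ 2 + (1 / (2 * B)) ^ 2) /
      (2 * Real.exp s * (1 / (2 * B))) = _
    rw [zero_sub, neg_sq, hsqrt, Real.exp_neg]
    have := Real.exp_pos s
    field_simp
    ring
  have hinj : ∀ {u v : ℝ}, 0 ≤ u → 0 ≤ v → Real.cosh u = Real.cosh v → u = v := by
    intro u v hu hv h
    exact Real.cosh_strictMonoOn.injOn hu hv h
  refine ⟨V 0, V l, z, ?_, hinj dist_nonneg ha ?_, hinj dist_nonneg hb ?_, fun s hs =>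
    ⟨V s, ⟨?_, ?_⟩, ?_⟩⟩
  · rw [hV, zero_sub, abs_neg, abs_of_pos hl]
  · rw [hz, ← hsum]; simp
  · rw [hz, hsum']
  · rw [hV, zero_sub, abs_neg, abs_of_nonneg hs.1]
  · rw [hV, abs_sub_comm, abs_of_nonneg (sub_nonneg.mpr hs.2)]
  · rw [hz, ← hsum, ← hsum']
    simp only [Real.sinh_eq, neg_sub, Real.exp_neg, Real.exp_sub]
    have := Real.exp_pos s
    have := Real.exp_pos l
    field_simp
    ring

variable {X : Type*} [MetricSpace X]

/-- Stewart's inequality in a `CAT(-1)` space. -/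
theorem IsCATNegOne.sinh_mul_cosh_dist_le (hX : IsCATNegOne X) {c : ℝ → X} {x y : X}
    (hc : IsGeodesicSegment c x y) {s : ℝ} (hs : s ∈ Set.Icc 0 (dist x y)) (z : X) :
    Real.sinh (dist x y) * Real.cosh (dist z (c s)) ≤
      Real.sinh (dist x y - s) * Real.cosh (dist z x) + Real.sinh s * Real.cosh (dist z y) := by
  rcases (dist_nonneg (x := x) (y := y)).eq_or_lt with h0 | hl
  · rw [← h0] at hs ⊢
    obtain rfl : s = 0 := le_antisymm hs.2 hs.1
    simp
  obtain ⟨c₂, hc₂⟩ := hX.geodesic x z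
  obtain ⟨c₃, hc₃⟩ := hX.geodesic y z
  obtain ⟨x', y', z', hxy, hxz, hyz, hp⟩ := exists_comparison_triangle hl
    (dist_nonneg (x := x) (y := z)) (dist_nonneg (x := y) (y := z))
    (by linarith [dist_triangle_left y z x]) (by
      rw [abs_le]
      constructor <;> linarith [dist_triangle x z y, dist_triangle x y z, dist_comm z y])
  obtain ⟨p, hp, hst⟩ := hp s hs
  -- The second comparison point is the vertex opposite to the side, at parameter `dist x z`.
  have h := hX.comparison x y z c c₂ c₃ hc hc₂ hc₃ x' y' z' hxy hxz hyz s hs (dist x z)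
    ⟨dist_nonneg, le_rfl⟩ p z' hp ⟨hxz, by simp⟩
  rw [hc₂.2.1] at h
  rw [dist_comm z x, dist_comm z y, ← hst, dist_comm z]
  gcongr
  rw [Real.cosh_le_cosh, abs_of_nonneg dist_nonneg, abs_of_nonneg dist_nonneg]
  exact h

end Comparison

/-! ### Exponential asymptotics of cosh and sinh, and compact-open convergence. -/

section Limits

variable {ι : Type*} {l : Filter ι} {a s : ι → ℝ} {A : ℝ}

/-- The product is e^{a-s} + e^{-(a-s)-2s}, whose second term vanishes. Such limits turn Stewart's
inequality into statements about Busemann functions. -/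
theorem tendsto_two_mul_exp_neg_mul_cosh (h : Tendsto (fun i => a i - s i) l (𝓝 A))
    (hs : Tendsto s l atTop) :
    Tendsto (fun i => 2 * Real.exp (-s i) * Real.cosh (a i)) l (𝓝 (Real.exp A)) := by
  have h1 : Tendsto (fun i => Real.exp (a i - s i)) l (𝓝 (Real.exp A)) :=
    (Real.continuous_exp.tendsto A).comp h
  have h2 : Tendsto (fun i => Real.exp (-(a i - s i) - 2 * s i)) l (𝓝 0) :=
    Real.tendsto_exp_atBot.comp (h.neg.add_atBot
      (tendsto_neg_atTop_atBot.comp (hs.const_mul_atTop two_pos)))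
  have h3 := h1.add h2
  rw [add_zero] at h3
  refine h3.congr fun i => ?_
  rw [Real.cosh_eq, show a i - s i = -s i + a i by ring,
    show -(-s i + a i) - 2 * s i = -s i + -a i by ring, Real.exp_add, Real.exp_add]
  ring

theorem tendsto_two_mul_exp_neg_mul_sinh (h : Tendsto (fun i => a i - s i) l (𝓝 A))
    (hs : Tendsto s l atTop) :
    Tendsto (fun i => 2 * Real.exp (-s i) * Real.sinh (a i)) l (𝓝 (Real.exp A)) := by
  have h1 : Tendsto (fun i => Real.exp (a i - s i)) l (𝓝 (Real.exp A)) :=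
    (Real.continuous_exp.tendsto A).comp h
  have h2 : Tendsto (fun i => Real.exp (-(a i - s i) - 2 * s i)) l (𝓝 0) :=
    Real.tendsto_exp_atBot.comp (h.neg.add_atBot
      (tendsto_neg_atTop_atBot.comp (hs.const_mul_atTop two_pos)))
  have h3 := h1.sub h2
  rw [sub_zero] at h3
  refine h3.congr fun i => ?_
  rw [Real.sinh_eq, show a i - s i = -s i + a i by ring,
    show -(-s i + a i) - 2 * s i = -s i + -a i by ring, Real.exp_add, Real.exp_add]
  ring

/-- For `1`-Lipschitz maps, pointwise convergence implies convergence in the compact-open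
topology. -/
theorem tendsto_continuousMap_of_lipschitz {Y Z : Type*} [MetricSpace Y] [LocallyCompactSpace Y]
    [MetricSpace Z] {F : ι → C(Y, Z)} {G : C(Y, Z)}
    (hF : ∀ i y z, dist (F i y) (F i z) ≤ dist y z)
    (h : ∀ y, Tendsto (fun i => F i y) l (𝓝 (G y))) : Tendsto F l (𝓝 G) := by
  rw [ContinuousMap.tendsto_iff_tendstoLocallyUniformly, Metric.tendstoLocallyUniformly_iff]
  intro ε hε x
  have h1 : ∀ᶠ y in 𝓝 x, dist (G y) (G x) < ε / 3 :=
    (G.continuous.tendsto x).eventually (Metric.ball_mem_nhds _ (by positivity))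
  have h2 : ∀ᶠ y in 𝓝 x, dist y x < ε / 3 := Metric.ball_mem_nhds _ (by positivity)
  refine ⟨_, h1.and h2, ?_⟩
  filter_upwards [(h x).eventually (Metric.ball_mem_nhds _ (show 0 < ε / 3 by positivity))]
    with i hi y hy
  have h3 := dist_triangle4 (G y) (G x) (F i x) (F i y)
  have h4 := hF i x y
  rw [dist_comm] at hi
  have h5 := hy.1
  have h6 := hy.2
  rw [dist_comm] at h6
  linarith

end Limits

/-! ### Busemann functions and distances to points on rays. -/

section Busemann

variable {X : Type*} [MetricSpace X]

theorem Ray.dist_eq (c : Ray X) (s t : ℝ≥0) : dist (c.1 s) (c.1 t) = |(s : ℝ) - t| := by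
  rw [c.2.dist_eq, NNReal.dist_eq]

theorem Ray.dist_zero (c : Ray X) (s : ℝ≥0) : dist (c.1 0) (c.1 s) = s := by
  rw [c.dist_eq, NNReal.coe_zero, zero_sub, abs_neg, abs_of_nonneg s.coe_nonneg]

theorem tendsto_nat_busemannFun (c : Ray X) (y : X) :
    Tendsto (fun n : ℕ => dist y (c.1 n) - n) atTop (𝓝 (busemannFun c y)) := by
  simpa [Function.comp_def] using
    (tendsto_busemannFun c y).comp (tendsto_natCast_atTop_atTop (R := ℝ≥0))

theorem busemannFun_le_dist_sub (c : Ray X) (y : X) (t : ℝ≥0) :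
    busemannFun c y ≤ dist y (c.1 t) - t := by
  refine le_of_tendsto (tendsto_busemannFun c y) ?_
  filter_upwards [eventually_ge_atTop t] with s hs
  have h1 := dist_triangle y (c.1 t) (c.1 s)
  have h2 : (t : ℝ) ≤ s := hs
  rw [c.dist_eq t s, abs_sub_comm, abs_of_nonneg (by linarith)] at h1
  linarith

theorem Ray.isGeodesicSegment (c : Ray X) (s : ℝ≥0) :
    IsGeodesicSegment (fun t : ℝ => c.1 t.toNNReal) (c.1 0) (c.1 s) := by
  refine ⟨by simp, by simp [c.dist_zero], fun a ha b hb => ?_⟩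
  rw [c.dist_eq, Real.coe_toNNReal _ ha.1, Real.coe_toNNReal _ hb.1]

/-- The exponential of a Busemann function is `sinh`-convex along segments. -/
theorem IsCATNegOne.sinh_mul_exp_busemannFun_le (hX : IsCATNegOne X) (b : Ray X) {c : ℝ → X}
    {x y : X} (hc : IsGeodesicSegment c x y) {s : ℝ} (hs : s ∈ Set.Icc 0 (dist x y)) :
    Real.sinh (dist x y) * Real.exp (busemannFun b (c s)) ≤
      Real.sinh (dist x y - s) * Real.exp (busemannFun b x) +
        Real.sinh s * Real.exp (busemannFun b y) := by
  have hlim : ∀ z, Tendsto (fun t : ℝ≥0 => 2 * Real.exp (-t) * Real.cosh (dist z (b.1 t))) atTop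
      (𝓝 (Real.exp (busemannFun b z))) := fun z =>
    tendsto_two_mul_exp_neg_mul_cosh (tendsto_busemannFun b z) (NNReal.tendsto_coe_atTop.mpr tendsto_id)
  refine le_of_tendsto_of_tendsto' ((hlim (c s)).const_mul _)
    (((hlim x).const_mul _).add ((hlim y).const_mul _)) fun t => ?_
  have h := hX.sinh_mul_cosh_dist_le hc hs (b.1 t)
  rw [dist_comm (b.1 t), dist_comm (b.1 t), dist_comm (b.1 t)] at h
  have := mul_le_mul_of_nonneg_left h (by positivity : 0 ≤ 2 * Real.exp (-(t : ℝ)))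
  linarith

/-- Stewart's inequality on the segment from `c 0` to `c s`, multiplied by 2e^{-s}, in the limit s →
∞. -/
theorem IsCATNegOne.cosh_dist_ray_le (hX : IsCATNegOne X) (c : Ray X) (z : X) (t : ℝ≥0) :
    Real.cosh (dist z (c.1 t)) ≤ Real.exp (-t) * Real.cosh (dist z (c.1 0)) +
      Real.sinh t * Real.exp (busemannFun c z) := by
  have hs : Tendsto (fun s : ℝ≥0 => (s : ℝ)) atTop atTop := NNReal.tendsto_coe_atTop.mpr tendsto_id
  have h1 : Tendsto (fun s : ℝ≥0 => 2 * Real.exp (-(s : ℝ)) * Real.sinh s) atTop (𝓝 1) := by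
    have := tendsto_two_mul_exp_neg_mul_sinh (a := fun s : ℝ≥0 => (s : ℝ)) (A := 0) (by simp) hs
    simpa using this
  have h2 : Tendsto (fun s : ℝ≥0 => 2 * Real.exp (-(s : ℝ)) * Real.sinh (s - t)) atTop
      (𝓝 (Real.exp (-t))) :=
    tendsto_two_mul_exp_neg_mul_sinh (by simp) hs
  have h3 := tendsto_two_mul_exp_neg_mul_cosh (tendsto_busemannFun c z) hs
  have h4 := h1.mul_const (Real.cosh (dist z (c.1 t)))
  rw [one_mul] at h4
  refine le_of_tendsto_of_tendsto h4
    ((h2.mul_const (Real.cosh (dist z (c.1 0)))).add (h3.const_mul (Real.sinh t))) ?_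
  filter_upwards [eventually_ge_atTop t] with s hst
  have hd := c.dist_zero s
  have h := hX.sinh_mul_cosh_dist_le (c.isGeodesicSegment s) (s := t)
    (by rw [hd]; exact ⟨t.2, hst⟩) z
  rw [hd, Real.toNNReal_coe] at h
  have := mul_le_mul_of_nonneg_left h (by positivity : 0 ≤ 2 * Real.exp (-(s : ℝ)))
  linarith

/-- Complements `busemannFun_le_dist_sub`: the error at time t depends on the ray only through its
origin, which gives the uniformity needed to vary the ray. -/
theorem IsCATNegOne.exp_dist_ray_sub_le (hX : IsCATNegOne X) (c : Ray X) (z : X) (t : ℝ≥0) :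
    Real.exp (dist z (c.1 t) - t) ≤
      Real.exp (busemannFun c z) + 2 * Real.exp (-2 * t) * Real.cosh (dist z (c.1 0)) := by
  have h := hX.cosh_dist_ray_le c z t
  have h1 : Real.exp (dist z (c.1 t)) ≤ 2 * Real.cosh (dist z (c.1 t)) := by
    rw [Real.cosh_eq]
    linarith [Real.exp_pos (-dist z (c.1 t))]
  have h2 : 2 * Real.sinh t ≤ Real.exp t := by
    rw [Real.sinh_eq]
    linarith [Real.exp_pos (-(t : ℝ))]
  have h3 : Real.exp (dist z (c.1 t)) ≤ 2 * (Real.exp (-t) * Real.cosh (dist z (c.1 0))) +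
      Real.exp t * Real.exp (busemannFun c z) := by
    have := mul_le_mul_of_nonneg_right h2 (Real.exp_pos (busemannFun c z)).le
    linarith
  rw [sub_eq_add_neg, Real.exp_add]
  have h4 := mul_le_mul_of_nonneg_right h3 (Real.exp_pos (-(t : ℝ))).le
  have h5 : Real.exp (-2 * t) = Real.exp (-t) * Real.exp (-t) := by
    rw [← Real.exp_add]; ring_nf
  have h6 : Real.exp t * Real.exp (-(t : ℝ)) = 1 := by rw [← Real.exp_add]; simp
  rw [h5]
  calc _ ≤ _ := h4
    _ = Real.exp t * Real.exp (-(t : ℝ)) * Real.exp (busemannFun c z) +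
        2 * (Real.exp (-t) * Real.exp (-t)) * Real.cosh (dist z (c.1 0)) := by ring
    _ ≤ _ := by rw [h6, one_mul]

/-- Busemann functions depend continuously on the ray. -/
theorem IsCATNegOne.tendsto_busemannFun_of_tendsto (hX : IsCATNegOne X) {ι : Type*} {l : Filter ι}
    {F : ι → Ray X} {c : Ray X} (h : ∀ t, Tendsto (fun i => (F i).1 t) l (𝓝 (c.1 t))) (z : X) :
    Tendsto (fun i => busemannFun (F i) z) l (𝓝 (busemannFun c z)) := by
  have hd : ∀ t, Tendsto (fun i => dist z ((F i).1 t)) l (𝓝 (dist z (c.1 t))) := fun t =>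
    tendsto_const_nhds.dist (h t)
  have hup : ∀ t : ℝ≥0, Tendsto (fun i => Real.exp (dist z ((F i).1 t) - t)) l
      (𝓝 (Real.exp (dist z (c.1 t) - t))) := fun t =>
    (Real.continuous_exp.tendsto _).comp ((hd t).sub_const _)
  have hlow : ∀ t : ℝ≥0, Tendsto (fun i => Real.exp (dist z ((F i).1 t) - t) -
      2 * Real.exp (-2 * t) * Real.cosh (dist z ((F i).1 0))) l
      (𝓝 (Real.exp (dist z (c.1 t) - t) - 2 * Real.exp (-2 * t) * Real.cosh (dist z (c.1 0)))) :=
    fun t => (hup t).sub (((Real.continuous_cosh.tendsto _).comp (hd 0)).const_mul _)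
  have hc : Tendsto (fun t : ℝ≥0 => Real.exp (dist z (c.1 t) - t)) atTop
      (𝓝 (Real.exp (busemannFun c z))) :=
    (Real.continuous_exp.tendsto _).comp (tendsto_busemannFun c z)
  have h0 : Tendsto (fun t : ℝ≥0 => Real.exp (-2 * (t : ℝ))) atTop (𝓝 0) :=
    Real.tendsto_exp_atBot.comp
      ((NNReal.tendsto_coe_atTop.mpr tendsto_id).const_mul_atTop_of_neg (by norm_num))
  have hc' : Tendsto (fun t : ℝ≥0 => Real.exp (dist z (c.1 t) - t) -
      2 * Real.exp (-2 * t) * Real.cosh (dist z (c.1 0))) atTop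
      (𝓝 (Real.exp (busemannFun c z))) := by
    simpa using hc.sub ((h0.const_mul 2).mul_const (Real.cosh (dist z (c.1 0))))
  have hexp : Tendsto (fun i => Real.exp (busemannFun (F i) z)) l
      (𝓝 (Real.exp (busemannFun c z))) := by
    -- Fix a time t at which the limit ray is accurate enough, then let the rays vary: the lower
    -- bound uses the e^{-2t} estimate, the upper bound the monotonicity in t.
    refine tendsto_order.mpr ⟨fun a ha => ?_, fun a ha => ?_⟩
    · obtain ⟨t, ht⟩ := (hc'.eventually (lt_mem_nhds ha)).exists
      filter_upwards [(hlow t).eventually (lt_mem_nhds ht)] with i hi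
      linarith [hX.exp_dist_ray_sub_le (F i) z t]
    · obtain ⟨t, ht⟩ := (hc.eventually (gt_mem_nhds ha)).exists
      filter_upwards [(hup t).eventually (gt_mem_nhds ht)] with i hi
      exact (Real.exp_le_exp.mpr (busemannFun_le_dist_sub (F i) z t)).trans_lt hi
  simpa using hexp.log (Real.exp_pos _).ne'

/-- The point at distance `T` from `z` on a ray from `z` asymptotic to `c`. -/
theorem IsCATNegOne.exists_shadow [ProperSpace X] (hX : IsCATNegOne X) (c : Ray X) (z : X) {T : ℝ}
    (hT : 0 ≤ T) : ∃ y, ∀ w, Real.cosh (dist w y) ≤ Real.exp (-T) * Real.cosh (dist w z) +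
      Real.sinh T * Real.exp (busemannFun c w - busemannFun c z) := by
  choose σ hσ using fun n : ℕ => hX.geodesic z (c.1 n)
  have hl : Tendsto (fun n : ℕ => dist z (c.1 n)) atTop atTop := by
    have := (tendsto_nat_busemannFun c z).add_atTop (tendsto_natCast_atTop_atTop (R := ℝ))
    simpa using this
  have hev : ∀ᶠ n : ℕ in atTop, T ∈ Set.Icc 0 (dist z (c.1 n)) :=
    (hl.eventually_ge_atTop T).mono fun n hn => ⟨hT, hn⟩
  have hball : ∀ᶠ n : ℕ in atTop, σ n T ∈ Metric.closedBall z T := by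
    filter_upwards [hev] with n hn
    rw [Metric.mem_closedBall, dist_comm]
    nth_rewrite 1 [← (hσ n).1]
    rw [(hσ n).2.2 _ ⟨le_rfl, dist_nonneg⟩ _ hn, zero_sub, abs_neg, abs_of_nonneg hT]
  -- The point is a cluster point of the points at distance T from `z` on the segments to `c n`;
  -- Stewart's inequality on these segments passes to the limit.
  obtain ⟨y, -, φ, hφ, hy⟩ := (isCompact_closedBall z T).tendsto_subseq' hball.frequently
  refine ⟨y, fun w => ?_⟩
  have h1 : Tendsto (fun n : ℕ => 2 * Real.exp (-dist z (c.1 n)) * Real.sinh (dist z (c.1 n)))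
      atTop (𝓝 1) := by
    simpa using tendsto_two_mul_exp_neg_mul_sinh (a := fun n : ℕ => dist z (c.1 n)) (A := 0)
      (by simp) hl
  have h2 : Tendsto (fun n : ℕ => 2 * Real.exp (-dist z (c.1 n)) * Real.sinh (dist z (c.1 n) - T))
      atTop (𝓝 (Real.exp (-T))) :=
    tendsto_two_mul_exp_neg_mul_sinh (by simp) hl
  have h3 : Tendsto (fun n : ℕ => 2 * Real.exp (-dist z (c.1 n)) * Real.cosh (dist w (c.1 n)))
      atTop (𝓝 (Real.exp (busemannFun c w - busemannFun c z))) :=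
    tendsto_two_mul_exp_neg_mul_cosh
      (((tendsto_nat_busemannFun c w).sub (tendsto_nat_busemannFun c z)).congr fun n => by ring) hl
  have h4 : Tendsto (fun n => Real.cosh (dist w (σ (φ n) T))) atTop (𝓝 (Real.cosh (dist w y))) :=
    (Real.continuous_cosh.tendsto _).comp (tendsto_const_nhds.dist hy)
  have h5 := (h1.comp hφ.tendsto_atTop).mul h4
  rw [one_mul] at h5
  refine le_of_tendsto_of_tendsto h5 (((h2.mul_const (Real.cosh (dist w z))).add
    (h3.const_mul (Real.sinh T))).comp hφ.tendsto_atTop) ?_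
  filter_upwards [hφ.tendsto_atTop.eventually hev] with n hn
  have h := hX.sinh_mul_cosh_dist_le (hσ (φ n)) hn w
  have := mul_le_mul_of_nonneg_left h
    (by positivity : 0 ≤ 2 * Real.exp (-dist z (c.1 (φ n))))
  simp only [Function.comp_apply]
  linarith

end Busemann

/-! ### Geodesics joining distinct ideal points. -/

section Visibility

variable {X : Type*} [MetricSpace X]

theorem le_cosh_self {x : ℝ} (hx : 0 ≤ x) : x ≤ Real.cosh x :=
  (Real.self_le_sinh_iff.mpr hx).trans (Real.sinh_lt_cosh x).le

/-- Points near the middle of segments joining two rays stay bounded, with an explicit asymptotic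
bound in terms of the Busemann functions. -/
theorem IsCATNegOne.exists_tendsto_cosh_dist_le (hX : IsCATNegOne X) {c c' : Ray X} {ρ : ℝ}
    (hρ : Tendsto (fun n : ℕ => dist (c'.1 n) (c.1 n) - 2 * n) atTop (𝓝 (-(2 * ρ))))
    {σ : ℕ → ℝ → X} (hσ : ∀ n : ℕ, IsGeodesicSegment (σ n) (c'.1 n) (c.1 n)) (r : ℝ) (z : X) :
    ∃ U : ℕ → ℝ, Tendsto U atTop (𝓝 ((Real.exp (busemannFun c z + ρ + r) +
        Real.exp (busemannFun c' z + ρ - r)) / 2)) ∧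
      ∀ᶠ n in atTop, Real.cosh (dist z (σ n (dist (c'.1 n) (c.1 n) / 2 + r))) ≤ U n := by
  obtain ⟨h, hh⟩ : ∃ h : ℕ → ℝ, h = fun n : ℕ => dist (c'.1 n) (c.1 n) / 2 := ⟨_, rfl⟩
  have hL : ∀ n : ℕ, dist (c'.1 n) (c.1 n) = 2 * h n := fun n => by rw [hh]; ring
  have hsub : Tendsto (fun n => h n - n) atTop (𝓝 (-ρ)) := by
    have := hρ.div_const 2
    rw [show -(2 * ρ) / 2 = -ρ by ring] at this
    refine this.congr fun n => ?_
    rw [hL]; ring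
  have hinf : Tendsto h atTop atTop := by
    simpa using hsub.add_atTop (tendsto_natCast_atTop_atTop (R := ℝ))
  have h1 : Tendsto (fun n => 2 * Real.exp (-(2 * h n)) * Real.sinh (2 * h n)) atTop (𝓝 1) := by
    simpa using tendsto_two_mul_exp_neg_mul_sinh (a := fun n => 2 * h n) (A := 0) (by simp)
      (hinf.const_mul_atTop two_pos)
  have hs : ∀ q : ℝ, Tendsto (fun n => 2 * Real.exp (-h n) * Real.sinh (h n + q)) atTop
      (𝓝 (Real.exp q)) := fun q => tendsto_two_mul_exp_neg_mul_sinh (by simp) hinf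
  have hc : ∀ e : Ray X, Tendsto (fun n : ℕ => 2 * Real.exp (-h n) * Real.cosh (dist z (e.1 n)))
      atTop (𝓝 (Real.exp (busemannFun e z + ρ))) := fun e => by
    refine tendsto_two_mul_exp_neg_mul_cosh ?_ hinf
    have := (tendsto_nat_busemannFun e z).sub hsub
    rw [sub_neg_eq_add] at this
    exact this.congr fun n => by ring
  -- With h the half-length, the factor 2e^{-2h} in front of Stewart's inequality splits evenly: one
  -- e^{-h} normalizes each sinh(h ± r), the other each cosh of a distance.
  have hnum := (((hs (-r)).mul (hc c')).add ((hs r).mul (hc c))).div_const 2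
  refine ⟨fun n => (2 * Real.exp (-(2 * h n)) * Real.sinh (2 * h n))⁻¹ *
      ((2 * Real.exp (-h n) * Real.sinh (h n + -r) *
          (2 * Real.exp (-h n) * Real.cosh (dist z (c'.1 n))) +
        2 * Real.exp (-h n) * Real.sinh (h n + r) *
          (2 * Real.exp (-h n) * Real.cosh (dist z (c.1 n)))) / 2), ?_, ?_⟩
  · have := (h1.inv₀ one_ne_zero).mul hnum
    rw [inv_one, one_mul, ← Real.exp_add, ← Real.exp_add] at this
    convert this using 2
    rw [add_comm]
    ring_nf
  · filter_upwards [hinf.eventually_ge_atTop |r|, hinf.eventually_gt_atTop 0] with n hn hn0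
    have hr := abs_le.mp hn
    have hst := hX.sinh_mul_cosh_dist_le (hσ n) (s := dist (c'.1 n) (c.1 n) / 2 + r)
      (by rw [hL]; constructor <;> linarith) z
    have hpos : 0 < Real.sinh (2 * h n) := Real.sinh_pos_iff.mpr (by linarith)
    rw [← div_eq_inv_mul, le_div_iff₀ (by positivity)]
    rw [hL] at hst ⊢
    have hm := mul_le_mul_of_nonneg_left hst (by positivity : 0 ≤ 2 * Real.exp (-(2 * h n)))
    have he : Real.exp (-(2 * h n)) = Real.exp (-h n) * Real.exp (-h n) := by
      rw [← Real.exp_add]; ring_nf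
    rw [show 2 * h n - (2 * h n / 2 + r) = h n + -r by ring,
      show 2 * h n / 2 + r = h n + r by ring] at hm
    rw [show 2 * h n / 2 + r = h n + r by ring]
    calc _ = 2 * Real.exp (-(2 * h n)) * (Real.sinh (2 * h n) *
          Real.cosh (dist z (σ n (h n + r)))) := by ring
      _ ≤ _ := hm
      _ = _ := by rw [he]; ring

/-- Two rays whose Gromov product is infinite are asymptotic. -/
theorem IsCATNegOne.asymptotic_of_tendsto_atBot (hX : IsCATNegOne X) {c c' : Ray X}
    (h : Tendsto (fun n : ℕ => dist (c'.1 n) (c.1 n) - 2 * n) atTop atBot) :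
    c.endpoint = c'.endpoint := by
  -- The exponential of b_c is sinh-convex on the segment from `c' 0` to `c' n`. The contribution of
  -- the far end is controlled by exp(d(c'(n), c(n)) - 2n) → 0, so b_c decays at unit rate along
  -- `c'`.
  have hψ : ∀ t : ℝ≥0, Real.exp (busemannFun c (c'.1 t)) ≤
      Real.exp (-t) * Real.exp (busemannFun c (c'.1 0)) := by
    intro t
    have hs : Tendsto (fun n : ℕ => (n : ℝ)) atTop atTop := tendsto_natCast_atTop_atTop
    have h1 : Tendsto (fun n : ℕ => 2 * Real.exp (-(n : ℝ)) * Real.sinh n) atTop (𝓝 1) := by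
      simpa using tendsto_two_mul_exp_neg_mul_sinh (a := fun n : ℕ => (n : ℝ)) (A := 0)
        (by simp) hs
    have h2 : Tendsto (fun n : ℕ => 2 * Real.exp (-(n : ℝ)) * Real.sinh (n - t)) atTop
        (𝓝 (Real.exp (-t))) :=
      tendsto_two_mul_exp_neg_mul_sinh (by simp) hs
    have h3 := (Real.tendsto_exp_atBot.comp h).const_mul (2 * Real.sinh t)
    have h4 := (h2.mul_const (Real.exp (busemannFun c (c'.1 0)))).add h3
    rw [mul_zero, add_zero] at h4
    have h5 := h1.mul_const (Real.exp (busemannFun c (c'.1 t)))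
    rw [one_mul] at h5
    refine le_of_tendsto_of_tendsto h5 h4 ?_
    filter_upwards [hs.eventually_ge_atTop (t : ℝ)] with n hn
    have hd : dist (c'.1 0) (c'.1 n) = n := by simpa using c'.dist_zero n
    have hcv := hX.sinh_mul_exp_busemannFun_le c (c'.isGeodesicSegment n) (s := t)
      (by rw [hd]; exact ⟨t.coe_nonneg, hn⟩)
    rw [hd, Real.toNNReal_coe] at hcv
    have hb : Real.exp (busemannFun c (c'.1 n)) ≤ Real.exp (dist (c'.1 n) (c.1 n) - n) := by
      simpa using busemannFun_le_dist_sub c (c'.1 n) n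
    have hst : 0 ≤ Real.sinh t := Real.sinh_nonneg_iff.mpr t.coe_nonneg
    have hcv' := hcv.trans (add_le_add_right (mul_le_mul_of_nonneg_left hb hst) _)
    have hm := mul_le_mul_of_nonneg_left hcv' (by positivity : 0 ≤ 2 * Real.exp (-(n : ℝ)))
    have he : Real.exp (dist (c'.1 n) (c.1 n) - 2 * n) =
        Real.exp (-(n : ℝ)) * Real.exp (dist (c'.1 n) (c.1 n) - n) := by
      rw [← Real.exp_add]; ring_nf
    simp only [Function.comp_apply, he]
    linarith
  refine Quotient.sound
    ⟨Real.exp (dist (c'.1 0) (c.1 0)) + Real.exp (busemannFun c (c'.1 0)), fun t => ?_⟩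
  have h0 : dist (c'.1 t) (c.1 0) ≤ t + dist (c'.1 0) (c.1 0) := by
    have := dist_triangle (c'.1 t) (c'.1 0) (c.1 0)
    rwa [dist_comm (c'.1 t) (c'.1 0), c'.dist_zero] at this
  have hc0 : Real.cosh (dist (c'.1 t) (c.1 0)) ≤ Real.exp t * Real.exp (dist (c'.1 0) (c.1 0)) := by
    rw [← Real.exp_add]
    refine le_trans ?_ (Real.exp_le_exp.mpr h0)
    rw [← Real.cosh_add_sinh]
    linarith [Real.sinh_nonneg_iff.mpr (dist_nonneg (x := c'.1 t) (y := c.1 0))]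
  have hst : Real.sinh t ≤ Real.exp t := by
    rw [← Real.cosh_add_sinh]
    linarith [Real.cosh_pos (t : ℝ)]
  have he : Real.exp (-(t : ℝ)) * Real.exp t = 1 := by rw [← Real.exp_add]; simp
  rw [dist_comm]
  -- The decay of b_c along `c'` cancels the growth of sinh t in `cosh_dist_ray_le`, leaving a bound
  -- independent of t.
  calc dist (c'.1 t) (c.1 t) ≤ Real.cosh (dist (c'.1 t) (c.1 t)) := le_cosh_self dist_nonneg
    _ ≤ _ := hX.cosh_dist_ray_le c _ t
    _ ≤ Real.exp (-t) * (Real.exp t * Real.exp (dist (c'.1 0) (c.1 0))) +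
        Real.exp t * (Real.exp (-t) * Real.exp (busemannFun c (c'.1 0))) := by
      gcongr
      exact hψ t
    _ = Real.exp (-(t : ℝ)) * Real.exp t *
        (Real.exp (dist (c'.1 0) (c.1 0)) + Real.exp (busemannFun c (c'.1 0))) := by ring
    _ = _ := by rw [he, one_mul]

/-- By the triangle inequality the sequence is antitone, so it converges unless it tends to -∞,
which would make the rays asymptotic. -/
theorem IsCATNegOne.exists_tendsto_gromovProduct (hX : IsCATNegOne X) {c c' : Ray X}
    (h : c.endpoint ≠ c'.endpoint) :
    ∃ ρ : ℝ, Tendsto (fun n : ℕ => dist (c'.1 n) (c.1 n) - 2 * n) atTop (𝓝 (-(2 * ρ))) := by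
  have hanti : Antitone (fun n : ℕ => dist (c'.1 n) (c.1 n) - 2 * (n : ℝ)) := by
    refine antitone_nat_of_succ_le fun n => ?_
    have h1 := dist_triangle4 (c'.1 (n + 1 : ℕ)) (c'.1 n) (c.1 n) (c.1 (n + 1 : ℕ))
    rw [c'.dist_eq, c.dist_eq] at h1
    push_cast at h1 ⊢
    rw [show (n : ℝ) + 1 - n = 1 by ring, show (n : ℝ) - (n + 1) = -1 by ring, abs_neg, abs_one]
      at h1
    linarith
  rcases tendsto_atTop_of_antitone hanti with h1 | ⟨A, h1⟩
  · exact absurd (hX.asymptotic_of_tendsto_atBot h1) h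
  · exact ⟨-A / 2, by convert h1 using 2; ring⟩

theorem busemannFun_le_of_cosh_dist_le {e : Ray X} {z : X} {A B : ℝ}
    (h : ∀ t : ℝ≥0, Real.cosh (dist z (e.1 t)) ≤ (Real.exp (A + t) + Real.exp (B - t)) / 2) :
    busemannFun e z ≤ A := by
  have hs : Tendsto (fun t : ℝ≥0 => (t : ℝ)) atTop atTop := NNReal.tendsto_coe_atTop.mpr tendsto_id
  have h1 := tendsto_two_mul_exp_neg_mul_cosh (tendsto_busemannFun e z) hs
  have h2 : Tendsto (fun t : ℝ≥0 => Real.exp A + Real.exp (B - 2 * t)) atTop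
      (𝓝 (Real.exp A + 0)) :=
    tendsto_const_nhds.add (Real.tendsto_exp_atBot.comp (tendsto_const_nhds.add_atBot
      (tendsto_neg_atTop_atBot.comp (hs.const_mul_atTop two_pos))))
  rw [add_zero] at h2
  rw [← Real.exp_le_exp]
  refine le_of_tendsto_of_tendsto' h1 h2 fun t => ?_
  have hm := mul_le_mul_of_nonneg_left (h t) (by positivity : 0 ≤ 2 * Real.exp (-(t : ℝ)))
  refine hm.trans_eq ?_
  have h3 : Real.exp A = Real.exp (-t) * Real.exp (A + t) := by rw [← Real.exp_add]; ring_nf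
  have h4 : Real.exp (B - 2 * t) = Real.exp (-t) * Real.exp (B - t) := by
    rw [← Real.exp_add]; ring_nf
  rw [h3, h4]
  ring

/-- The forward ray of a geodesic. -/
def Geodesic.posRay (g : Geodesic X) : Ray X :=
  ⟨fun t => g.1 t, g.2.comp isometry_subtype_coe⟩

/-- The backward ray of a geodesic. -/
def Geodesic.negRay (g : Geodesic X) : Ray X :=
  ⟨fun t => g.1 (-t), g.2.comp ((IsometryEquiv.neg ℝ).isometry.comp isometry_subtype_coe)⟩

theorem Geodesic.dist_eq (g : Geodesic X) (s t : ℝ) : dist (g.1 s) (g.1 t) = |s - t| := by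
  rw [g.2.dist_eq, Real.dist_eq]

theorem Geodesic.busemannFun_posRay (g : Geodesic X) (t : ℝ) :
    busemannFun g.posRay (g.1 t) = -t := by
  refine tendsto_nhds_unique (tendsto_busemannFun _ _) (tendsto_const_nhds.congr' ?_)
  filter_upwards [eventually_ge_atTop t.toNNReal] with s hs
  have h2 : t ≤ s := Real.toNNReal_le_iff_le_coe.mp hs
  change _ = dist (g.1 t) (g.1 s) - s
  rw [g.dist_eq, abs_sub_comm, abs_of_nonneg (by linarith)]
  ring

theorem Geodesic.busemannFun_negRay (g : Geodesic X) (t : ℝ) :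
    busemannFun g.negRay (g.1 t) = t := by
  refine tendsto_nhds_unique (tendsto_busemannFun _ _) (tendsto_const_nhds.congr' ?_)
  filter_upwards [eventually_ge_atTop (-t).toNNReal] with s hs
  have h2 : -t ≤ s := Real.toNNReal_le_iff_le_coe.mp hs
  change _ = dist (g.1 t) (g.1 (-s)) - s
  rw [g.dist_eq, abs_of_nonneg (by linarith)]
  ring

theorem Geodesic.endpoint_ne (g : Geodesic X) : g.posRay.endpoint ≠ g.negRay.endpoint := by
  intro h
  obtain ⟨C, hC⟩ := Quotient.exact h
  have h1 := hC (C.toNNReal + 1)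
  change dist (g.1 ((C.toNNReal + 1 : ℝ≥0) : ℝ)) (g.1 (-((C.toNNReal + 1 : ℝ≥0) : ℝ))) ≤ C at h1
  have h2 := Real.le_coe_toNNReal C
  have h3 := C.toNNReal.coe_nonneg
  rw [g.dist_eq] at h1
  push_cast at h1
  have h4 := (le_abs_self _).trans h1
  linarith

/-- The midpoint estimate for the two rays of `g`, joined by pieces of `g` itself; here ρ = 0. -/
theorem IsCATNegOne.cosh_dist_geodesic_le (hX : IsCATNegOne X) (g : Geodesic X) (z : X) (r : ℝ) :
    Real.cosh (dist z (g.1 r)) ≤ (Real.exp (busemannFun g.posRay z + r) +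
      Real.exp (busemannFun g.negRay z - r)) / 2 := by
  have hd : ∀ n : ℕ, dist (g.negRay.1 n) (g.posRay.1 n) = 2 * n := by
    intro n
    change dist (g.1 (-((n : ℝ≥0) : ℝ))) (g.1 ((n : ℝ≥0) : ℝ)) = _
    rw [g.dist_eq, abs_sub_comm, abs_of_nonneg (by simp)]
    push_cast
    ring
  have hσ : ∀ n : ℕ, IsGeodesicSegment (fun t => g.1 (t - n)) (g.negRay.1 n) (g.posRay.1 n) := by
    intro n
    refine ⟨?_, ?_, fun s _ t _ => ?_⟩
    · change g.1 (0 - n) = g.1 (-((n : ℝ≥0) : ℝ))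
      simp
    · change g.1 (dist (g.negRay.1 n) (g.posRay.1 n) - n) = g.1 ((n : ℝ≥0) : ℝ)
      rw [hd]
      congr 1
      push_cast
      ring
    · rw [g.dist_eq]
      congr 1
      ring
  obtain ⟨U, hU, hle⟩ := hX.exists_tendsto_cosh_dist_le (c := g.posRay) (c' := g.negRay) (ρ := 0)
    (by simp [hd]) hσ r z
  rw [add_zero, add_zero] at hU
  refine ge_of_tendsto hU (hle.mono fun n hn => ?_)
  rwa [hd, show 2 * (n : ℝ) / 2 + r - n = r by ring] at hn

/-- Visibility: distinct ideal points are the endpoints of a geodesic, which moreover can be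
parametrized so that its two Busemann functions differ from given ones by the same constant. -/
theorem IsCATNegOne.exists_geodesic [ProperSpace X] (hX : IsCATNegOne X) {c c' : Ray X}
    (h : c.endpoint ≠ c'.endpoint) : ∃ (g : Geodesic X) (ρ : ℝ), ∀ z,
      busemannFun g.posRay z = busemannFun c z + ρ ∧
        busemannFun g.negRay z = busemannFun c' z + ρ := by
  obtain ⟨ρ, hρ⟩ := hX.exists_tendsto_gromovProduct h
  choose σ hσ using fun n : ℕ => hX.geodesic (c'.1 n) (c.1 n)
  have hinf : Tendsto (fun n : ℕ => dist (c'.1 n) (c.1 n) / 2) atTop atTop := by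
    have := (hρ.add_atTop ((tendsto_natCast_atTop_atTop (R := ℝ)).const_mul_atTop two_pos))
    simpa using this.atTop_div_const two_pos
  have hmem : ∀ r : ℝ, ∀ᶠ n : ℕ in atTop, dist (c'.1 n) (c.1 n) / 2 + r ∈
      Set.Icc 0 (dist (c'.1 n) (c.1 n)) := by
    intro r
    filter_upwards [hinf.eventually_ge_atTop |r|] with n hn
    have hr := abs_le.mp hn
    constructor <;> linarith
  -- Limits along one fixed ultrafilter exist for all r simultaneously, so no diagonal extraction is
  -- required.
  have hlim : ∀ r : ℝ, ∃ x : X, Tendsto (fun n : ℕ => σ n (dist (c'.1 n) (c.1 n) / 2 + r))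
      (hyperfilter ℕ : Filter ℕ) (𝓝 x) := by
    intro r
    obtain ⟨U, hU, hle⟩ := hX.exists_tendsto_cosh_dist_le hρ hσ r (c.1 0)
    obtain ⟨B, hB⟩ : ∃ B, ∀ᶠ n in atTop, U n ≤ B :=
      ⟨_, (hU.eventually (gt_mem_nhds (lt_add_one _))).mono fun n hn => le_of_lt hn⟩
    have hball : ∀ᶠ n : ℕ in atTop,
        σ n (dist (c'.1 n) (c.1 n) / 2 + r) ∈ Metric.closedBall (c.1 0) B := by
      filter_upwards [hle, hB] with n h1 h2
      rw [Metric.mem_closedBall, dist_comm]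
      exact (le_cosh_self dist_nonneg).trans (h1.trans h2)
    obtain ⟨x, -, hx⟩ := (isCompact_closedBall (c.1 0) B).ultrafilter_le_nhds
      ((hyperfilter ℕ).map fun n : ℕ => σ n (dist (c'.1 n) (c.1 n) / 2 + r))
      (le_principal_iff.mpr (hball.filter_mono Nat.hyperfilter_le_atTop))
    exact ⟨x, hx⟩
  choose G hG using hlim
  have hiso : Isometry G := by
    refine Isometry.of_dist_eq fun r r' => tendsto_nhds_unique ((hG r).dist (hG r')) ?_
    refine tendsto_const_nhds.congr' (Filter.EventuallyEq.filter_mono ?_ Nat.hyperfilter_le_atTop)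
    filter_upwards [hmem r, hmem r'] with n h1 h2
    rw [(hσ n).2.2 _ h1 _ h2, Real.dist_eq]
    congr 1
    ring
  have hcosh : ∀ z r, Real.cosh (dist z (G r)) ≤ (Real.exp (busemannFun c z + ρ + r) +
      Real.exp (busemannFun c' z + ρ - r)) / 2 := by
    intro z r
    obtain ⟨U, hU, hle⟩ := hX.exists_tendsto_cosh_dist_le hρ hσ r z
    exact le_of_tendsto_of_tendsto
      ((Real.continuous_cosh.tendsto _).comp (tendsto_const_nhds.dist (hG r)))
      (hU.mono_left Nat.hyperfilter_le_atTop) (hle.filter_mono Nat.hyperfilter_le_atTop)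
  have hhalf : ∀ q : ℝ, Tendsto (fun n : ℕ => dist (c'.1 n) (c.1 n) / 2 + q - n)
      (hyperfilter ℕ : Filter ℕ) (𝓝 (-ρ + q)) := by
    intro q
    have := (hρ.div_const 2).add_const q
    rw [show -(2 * ρ) / 2 = -ρ by ring] at this
    exact (this.congr fun n => by ring).mono_left Nat.hyperfilter_le_atTop
  have hbc : ∀ r, busemannFun c (G r) ≤ -ρ + -r := by
    intro r
    refine le_of_tendsto_of_tendsto (((continuous_busemannFun c).tendsto _).comp (hG r))
      (hhalf (-r)) (Filter.Eventually.filter_mono Nat.hyperfilter_le_atTop ?_)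
    filter_upwards [hmem r] with n hn
    refine (busemannFun_le_dist_sub c _ n).trans ?_
    have h1 := (hσ n).2.2 _ hn _ ⟨dist_nonneg, le_rfl⟩
    rw [(hσ n).2.1, abs_sub_comm, abs_of_nonneg (by linarith [hn.2])] at h1
    rw [h1, NNReal.coe_natCast]
    linarith
  have hbc' : ∀ r, busemannFun c' (G r) ≤ -ρ + r := by
    intro r
    refine le_of_tendsto_of_tendsto (((continuous_busemannFun c').tendsto _).comp (hG r))
      (hhalf r) (Filter.Eventually.filter_mono Nat.hyperfilter_le_atTop ?_)
    filter_upwards [hmem r] with n hn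
    refine (busemannFun_le_dist_sub c' _ n).trans ?_
    have h1 := (hσ n).2.2 _ hn _ ⟨le_rfl, dist_nonneg⟩
    rw [(hσ n).1, sub_zero, abs_of_nonneg hn.1] at h1
    rw [h1, NNReal.coe_natCast]
  -- Upper bounds come from `hcosh`. Lower bounds come from the 1-Lipschitz property together with
  -- `hbc` and `hbc'`, which control the given Busemann functions along `G`.
  refine ⟨⟨⟨G, hiso.continuous⟩, hiso⟩, ρ, fun z => ⟨le_antisymm ?_ ?_, le_antisymm ?_ ?_⟩⟩
  · exact busemannFun_le_of_cosh_dist_le fun t => hcosh z t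
  · refine ge_of_tendsto' (tendsto_busemannFun _ z) fun t => ?_
    change _ ≤ dist z (G t) - t
    linarith [busemannFun_sub_le c z (G t), hbc t]
  · refine busemannFun_le_of_cosh_dist_le (B := busemannFun c z + ρ)
      fun t => (hcosh z (-t)).trans_eq ?_
    rw [sub_neg_eq_add, ← sub_eq_add_neg, add_comm]
  · refine ge_of_tendsto' (tendsto_busemannFun _ z) fun t => ?_
    change _ ≤ dist z (G (-t)) - t
    linarith [busemannFun_sub_le c' z (G (-t)), hbc' (-t)]

end Visibility

/-! ### The boundary point of a geodesic, and recovery of the geodesic from it. -/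

section EndMap

variable {X : Type*} [MetricSpace X]

theorem continuous_cls (Y : Type*) [MetricSpace Y] : Continuous (cls : C(Y, ℝ) → CStar Y) :=
  continuous_quotient_mk'

theorem cls_eq_of_add_const {Y : Type*} [MetricSpace Y] {h h' : C(Y, ℝ)} (r : ℝ)
    (hr : ∀ y, h' y = h y + r) : cls h = cls h' := by
  refine QuotientAddGroup.eq.mpr ⟨r, ContinuousMap.ext fun y => ?_⟩
  change r = -h y + h' y
  rw [hr]
  ring

/-- The difference of the values at two points of a function modulo constants. -/
def valueDiff {Y : Type*} [MetricSpace Y] (P Q : Y) : CStar Y → ℝ :=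
  Quotient.lift (fun h : C(Y, ℝ) => h P - h Q) (by
    intro a b hab
    obtain ⟨r, hr⟩ := QuotientAddGroup.leftRel_apply.mp hab
    have h1 : r = -a P + b P := DFunLike.congr_fun hr P
    have h2 : r = -a Q + b Q := DFunLike.congr_fun hr Q
    change a P - a Q = b P - b Q
    linarith)

theorem continuous_valueDiff {Y : Type*} [MetricSpace Y] (P Q : Y) :
    Continuous (valueDiff P Q) :=
  Continuous.quotient_lift (by fun_prop) _

theorem dist_maxBusemann_le (c c' : Ray X) (P Q : X × X) :
    dist (maxBusemann c c' P) (maxBusemann c c' Q) ≤ dist P Q := by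
  have hb : ∀ (e : Ray X) (y z : X), |busemannFun e y - busemannFun e z| ≤ dist y z := by
    intro e y z
    rw [abs_le]
    have h1 := busemannFun_sub_le e y z
    have h2 := busemannFun_sub_le e z y
    rw [dist_comm z y] at h2
    constructor <;> linarith
  exact (abs_max_sub_max_le_max _ _ _ _).trans (max_le_max (hb c _ _) (hb c' _ _))

/-- The boundary point of `X × X` defined by a geodesic. -/
noncomputable def Geodesic.boundaryPoint (g : Geodesic X) : CStar (X × X) :=
  cls (maxBusemann g.posRay g.negRay)

theorem Geodesic.tendsto_iota [ProperSpace X] (g : Geodesic X) :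
    Tendsto (fun n : ℕ => iota (g.1 (n : ℝ), g.1 (-(n : ℝ)))) atTop (𝓝 g.boundaryPoint) := by
  let D : ℕ → C(X × X, ℝ) := fun n =>
    ⟨fun z => dist (g.1 (n : ℝ), g.1 (-(n : ℝ))) z - n, by fun_prop⟩
  have hD : ∀ n : ℕ, iota (g.1 (n : ℝ), g.1 (-(n : ℝ))) = cls (D n) := fun n =>
    cls_eq_of_add_const (-n) fun z => by rw [← sub_eq_add_neg]; rfl
  simp only [hD]
  refine ((continuous_cls _).tendsto _).comp (tendsto_continuousMap_of_lipschitz ?_ ?_)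
  · intro n y z
    change dist (dist _ y - (n : ℝ)) (dist _ z - (n : ℝ)) ≤ _
    rw [dist_sub_right, dist_comm _ y, dist_comm _ z]
    exact (dist_dist_dist_le_left _ _ _)
  · intro z
    have h := (tendsto_nat_busemannFun g.posRay z.1).max (tendsto_nat_busemannFun g.negRay z.2)
    refine h.congr fun n => ?_
    change max (dist z.1 (g.1 ((n : ℝ≥0) : ℝ)) - n) (dist z.2 (g.1 (-((n : ℝ≥0) : ℝ))) - n) =
      dist (g.1 (n : ℝ), g.1 (-(n : ℝ))) (z.1, z.2) - n
    rw [dist_prod_eq_max, dist_comm z.1, dist_comm z.2, NNReal.coe_natCast, max_sub_sub_right]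

/-- The representative equals -t at (g(t), g(-t)), hence is unbounded below, whereas a distance
function attains its minimum at its base point. -/
theorem Geodesic.boundaryPoint_mem [ProperSpace X] (g : Geodesic X) :
    g.boundaryPoint ∈ idealDomain X := by
  refine ⟨⟨mem_closure_of_tendsto g.tendsto_iota
    (Eventually.of_forall fun n => Set.mem_range_self _), ?_⟩, _, _, g.endpoint_ne, rfl⟩
  rintro ⟨P, hP⟩
  have h1 : ∀ t : ℝ, valueDiff (g.1 t, g.1 (-t)) P g.boundaryPoint =
      -t - maxBusemann g.posRay g.negRay P := by
    intro t
    change max (busemannFun g.posRay (g.1 t)) (busemannFun g.negRay (g.1 (-t))) - _ = _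
    rw [g.busemannFun_posRay, g.busemannFun_negRay, max_self]
  have h2 : ∀ Q : X × X, 0 ≤ valueDiff Q P (iota P) := by
    intro Q
    change 0 ≤ dist P Q - dist P P
    rw [dist_self, sub_zero]
    exact dist_nonneg
  have h3 := h2 (g.1 (1 - maxBusemann g.posRay g.negRay P),
    g.1 (-(1 - maxBusemann g.posRay g.negRay P)))
  rw [hP, h1] at h3
  linarith

theorem IsCATNegOne.exists_boundaryPoint_eq [ProperSpace X] (hX : IsCATNegOne X)
    {F : CStar (X × X)} (hF : F ∈ idealDomain X) : ∃ g : Geodesic X, g.boundaryPoint = F := by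
  obtain ⟨-, c, c', hne, rfl⟩ := hF
  obtain ⟨g, ρ, h⟩ := hX.exists_geodesic hne
  refine ⟨g, (cls_eq_of_add_const ρ fun z => ?_).symm⟩
  change max (busemannFun g.posRay z.1) (busemannFun g.negRay z.2) =
    max (busemannFun c z.1) (busemannFun c' z.2) + ρ
  rw [(h z.1).1, (h z.2).2, max_add_add_right]

theorem boundaryPoint_translate (γ : X ≃ᵢ X) (g : Geodesic X) :
    (Geodesic.translate γ g).boundaryPoint = act (diag γ) g.boundaryPoint := by
  have hb : ∀ {c c' : Ray X}, (∀ t, c'.1 t = γ (c.1 t)) →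
      ∀ y, busemannFun c' y = busemannFun c (γ.symm y) := by
    intro c c' h y
    refine tendsto_nhds_unique (tendsto_busemannFun c' y)
      ((tendsto_busemannFun c (γ.symm y)).congr fun t => ?_)
    rw [h, ← γ.dist_eq, γ.apply_symm_apply]
  refine congrArg cls (ContinuousMap.ext fun z => ?_)
  change max (busemannFun (Geodesic.translate γ g).posRay z.1)
    (busemannFun (Geodesic.translate γ g).negRay z.2) =
    max (busemannFun g.posRay (γ.symm z.1)) (busemannFun g.negRay (γ.symm z.2))
  rw [hb (c := g.posRay) (c' := (Geodesic.translate γ g).posRay) (fun _ => rfl),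
    hb (c := g.negRay) (c' := (Geodesic.translate γ g).negRay) (fun _ => rfl)]

/-- For s < 0 the limit of the maximum at (s, 0) is positive, while m is nonpositive at 0, so p
realizes the maximum. For s ≥ 0 the maximum at (s, -s) bounds p from above, and the Lipschitz
estimate from -1 to s bounds it from below by a quantity with the same limit. -/
theorem tendsto_of_tendsto_max {ι : Type*} {l : Filter ι} {p m : ι → ℝ → ℝ}
    (hmax : ∀ s t, Tendsto (fun i => max (p i s) (m i t)) l (𝓝 (max (-s) t)))
    (hp : ∀ i s s', p i s - p i s' ≤ |s - s'|) (hm : ∀ i, m i 0 ≤ 0) (s : ℝ) :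
    Tendsto (fun i => p i s) l (𝓝 (-s)) := by
  have hneg : ∀ s < 0, Tendsto (fun i => p i s) l (𝓝 (-s)) := by
    intro s hs
    have h := hmax s 0
    rw [max_eq_left (by linarith)] at h
    refine h.congr' ?_
    filter_upwards [h.eventually (lt_mem_nhds (by linarith : 0 < -s))] with i hi
    rcases lt_max_iff.mp hi with h1 | h1
    · exact max_eq_left ((hm i).trans h1.le)
    · exact absurd (hm i) (not_le.mpr h1)
  rcases lt_or_ge s 0 with hs | hs
  · exact hneg s hs
  · have h := hmax s (-s)
    rw [max_self] at h
    have h1 := (hneg (-1) (by norm_num)).sub_const (s + 1)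
    rw [show -(-1) - (s + 1) = -s by ring] at h1
    refine tendsto_of_tendsto_of_tendsto_of_le_of_le h1 h (fun i => ?_) fun i => le_max_left _ _
    have h2 := hp i (-1) s
    rw [abs_sub_comm, abs_of_nonneg (by linarith)] at h2
    change p i (-1) - (s + 1) ≤ p i s
    linarith

theorem sinh_le_sqrt_of_cosh_le {x C : ℝ} (h : Real.cosh x ≤ C) :
    Real.sinh x ≤ Real.sqrt (C ^ 2 - 1) := by
  refine Real.le_sqrt_of_sq_le ?_
  rw [Real.sinh_sq]
  have := pow_le_pow_left₀ (Real.cosh_pos x).le h 2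
  linarith

/-- The geodesic moves little if its boundary point does. -/
theorem IsCATNegOne.tendsto_of_tendsto_boundaryPoint [ProperSpace X] (hX : IsCATNegOne X)
    {ι : Type*} {l : Filter ι} {F : ι → Geodesic X} {g : Geodesic X}
    (h : Tendsto (fun i => (F i).boundaryPoint) l (𝓝 g.boundaryPoint)) :
    Tendsto F l (𝓝 g) := by
  -- k is the value of the representative at (g(0), g(0)), the constant invisible modulo constants;
  -- p and m are the Busemann functions along `g` normalized by it.
  obtain ⟨k, hk⟩ : ∃ k : ι → ℝ, k = fun i => max (busemannFun (F i).posRay (g.1 0))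
    (busemannFun (F i).negRay (g.1 0)) := ⟨_, rfl⟩
  obtain ⟨p, hp⟩ : ∃ p : ι → ℝ → ℝ, p = fun i s => busemannFun (F i).posRay (g.1 s) - k i :=
    ⟨_, rfl⟩
  obtain ⟨m, hm⟩ : ∃ m : ι → ℝ → ℝ, m = fun i s => busemannFun (F i).negRay (g.1 s) - k i :=
    ⟨_, rfl⟩
  have hp' : ∀ i s, busemannFun (F i).posRay (g.1 s) = p i s + k i := fun i s => by rw [hp]; ring
  have hm' : ∀ i s, busemannFun (F i).negRay (g.1 s) = m i s + k i := fun i s => by rw [hm]; ring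
  have hmax : ∀ s t, Tendsto (fun i => max (p i s) (m i t)) l (𝓝 (max (-s) t)) := by
    intro s t
    have h1 := ((continuous_valueDiff (g.1 s, g.1 t) (g.1 0, g.1 0)).tendsto _).comp h
    have h2 : valueDiff (g.1 s, g.1 t) (g.1 0, g.1 0) g.boundaryPoint = max (-s) t := by
      change max (busemannFun g.posRay (g.1 s)) (busemannFun g.negRay (g.1 t)) -
        max (busemannFun g.posRay (g.1 0)) (busemannFun g.negRay (g.1 0)) = _
      simp only [g.busemannFun_posRay, g.busemannFun_negRay, neg_zero, max_self, sub_zero]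
    rw [h2] at h1
    refine h1.congr fun i => ?_
    change max (busemannFun (F i).posRay (g.1 s)) (busemannFun (F i).negRay (g.1 t)) -
        max (busemannFun (F i).posRay (g.1 0)) (busemannFun (F i).negRay (g.1 0)) = _
    rw [hp, hm, hk]
    exact (max_sub_sub_right _ _ _).symm
  have hp0 : ∀ i, p i 0 ≤ 0 := by
    intro i
    rw [hp, hk]
    exact sub_nonpos.mpr (le_max_left _ _)
  have hm0 : ∀ i, m i 0 ≤ 0 := by
    intro i
    rw [hm, hk]
    exact sub_nonpos.mpr (le_max_right _ _)
  have hpt : ∀ s, Tendsto (fun i => p i s) l (𝓝 (-s)) := by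
    refine tendsto_of_tendsto_max hmax (fun i s s' => ?_) hm0
    have := busemannFun_sub_le (F i).posRay (g.1 s) (g.1 s')
    rw [g.dist_eq, hp', hp'] at this
    linarith
  -- Reversing the direction of `g` exchanges the roles of p and m.
  have hmt : ∀ s, Tendsto (fun i => m i s) l (𝓝 s) := by
    intro s
    have := tendsto_of_tendsto_max (l := l) (p := fun i s => m i (-s)) (m := fun i s => p i (-s))
      (fun s t => ?_) (fun i s s' => ?_) (fun i => by simpa using hp0 i) (-s)
    · simpa using this
    · have := hmax (-t) (-s)
      simp only [neg_neg] at this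
      simpa only [max_comm] using this
    · have := busemannFun_sub_le (F i).negRay (g.1 (-s)) (g.1 (-s'))
      rw [g.dist_eq, hm', hm', neg_sub_neg, abs_sub_comm] at this
      linarith
  have hk0 : ∀ i, 0 ≤ k i := by
    intro i
    have h1 := (Real.one_le_cosh _).trans (hX.cosh_dist_geodesic_le (F i) (g.1 0) 0)
    rw [hp', hm', add_zero, sub_zero] at h1
    have h2 := Real.exp_le_exp.mpr (by linarith [hp0 i] : p i 0 + k i ≤ k i)
    have h3 := Real.exp_le_exp.mpr (by linarith [hm0 i] : m i 0 + k i ≤ k i)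
    exact Real.one_le_exp_iff.mp (by linarith)
  -- If k stayed away from 0, the point at distance 1 from `g 0` towards the backward end of `F i`,
  -- which is almost `g (-1)`, would have too small a value of b₊. Quantitatively, e^{-2k} is
  -- bounded below by a quantity tending to (e - e^{-1})/(2 sinh 1) = 1.
  have hkt : Tendsto k l (𝓝 0) := by
    obtain ⟨C, hC⟩ : ∃ C : ι → ℝ, C = fun i => Real.exp (-1) * Real.cosh 1 +
      Real.sinh 1 * Real.exp (m i (-1) - m i 0) := ⟨_, rfl⟩
    have hCt : Tendsto C l (𝓝 1) := by
      have h1 : Tendsto (fun i => Real.exp (m i (-1) - m i 0)) l (𝓝 (Real.exp (-1 - 0))) :=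
        (Real.continuous_exp.tendsto _).comp ((hmt (-1)).sub (hmt 0))
      have h2 := (h1.const_mul (Real.sinh 1)).const_add (Real.exp (-1) * Real.cosh 1)
      rw [hC]
      convert h2 using 2
      rw [sub_zero, mul_comm (Real.sinh 1), ← mul_add, Real.cosh_add_sinh, ← Real.exp_add]
      simp
    -- If cosh x ≤ C, then e^x = cosh x + sinh x ≤ C + √(C² - 1).
    obtain ⟨D, hD⟩ : ∃ D : ι → ℝ, D = fun i => C i + Real.sqrt (C i ^ 2 - 1) := ⟨_, rfl⟩
    have hDt : Tendsto D l (𝓝 1) := by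
      rw [hD]
      simpa using hCt.add ((hCt.pow 2).sub_const 1).sqrt
    have hs1 : 0 < Real.sinh 1 := Real.sinh_pos_iff.mpr one_pos
    have hkey : ∀ i, (Real.exp (p i (-1)) / D i - Real.exp (-1) * Real.exp (p i 0)) /
        (2 * Real.sinh 1 * Real.exp (-m i 0)) ≤ Real.exp (-(2 * k i)) := by
      intro i
      obtain ⟨y, hy⟩ := hX.exists_shadow (F i).negRay (g.1 0) zero_le_one
      -- The shadow estimate is applied to points far along the forward ray of `F i`, where b₋
      -- equals the parameter t exactly.
      have h1 : Real.exp (busemannFun (F i).posRay y) ≤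
          Real.exp (-1) * Real.exp (p i 0 + k i) + 2 * Real.sinh 1 * Real.exp (-(m i 0 + k i)) := by
        have hs : Tendsto (fun t : ℝ≥0 => (t : ℝ)) atTop atTop :=
          NNReal.tendsto_coe_atTop.mpr tendsto_id
        have hl := fun z => tendsto_two_mul_exp_neg_mul_cosh
          (tendsto_busemannFun (F i).posRay z) hs
        have h2 := ((hl (g.1 0)).const_mul (Real.exp (-1))).add_const
          (2 * Real.sinh 1 * Real.exp (-(m i 0 + k i)))
        rw [hp'] at h2
        refine le_of_tendsto_of_tendsto' (hl y) h2 fun t => ?_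
        have h3 := mul_le_mul_of_nonneg_left (hy ((F i).posRay.1 t))
          (by positivity : 0 ≤ 2 * Real.exp (-(t : ℝ)))
        have h4 : busemannFun (F i).negRay ((F i).posRay.1 t) = t := (F i).busemannFun_negRay t
        rw [h4, hm', dist_comm, dist_comm _ (g.1 0), sub_eq_add_neg, Real.exp_add] at h3
        have h5 : Real.exp (-(t : ℝ)) * Real.exp t = 1 := by rw [← Real.exp_add]; simp
        refine h3.trans_eq ?_
        linear_combination (2 * Real.sinh 1 * Real.exp (-(m i 0 + k i))) * h5
      have h2 : Real.exp (dist (g.1 (-1)) y) ≤ D i := by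
        have h3 := hy (g.1 (-1))
        rw [g.dist_eq, hm', hm', add_sub_add_right_eq_sub, sub_zero, abs_neg, abs_one] at h3
        have h4 : Real.cosh (dist (g.1 (-1)) y) ≤ C i := by rw [hC]; exact h3
        rw [← Real.cosh_add_sinh, hD]
        exact add_le_add h4 (sinh_le_sqrt_of_cosh_le h4)
      have hDpos : 0 < D i := (Real.exp_pos _).trans_le h2
      have h3 : Real.exp (p i (-1) + k i) ≤ D i * (Real.exp (-1) * Real.exp (p i 0 + k i) +
          2 * Real.sinh 1 * Real.exp (-(m i 0 + k i))) := by
        have h4 := busemannFun_sub_le (F i).posRay (g.1 (-1)) y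
        rw [hp'] at h4
        calc Real.exp (p i (-1) + k i) ≤
            Real.exp (dist (g.1 (-1)) y + busemannFun (F i).posRay y) :=
              Real.exp_le_exp.mpr (by linarith)
          _ = Real.exp (dist (g.1 (-1)) y) * Real.exp (busemannFun (F i).posRay y) :=
              Real.exp_add _ _
          _ ≤ _ := mul_le_mul h2 h1 (Real.exp_pos _).le hDpos.le
      rw [div_le_iff₀ (by positivity), sub_le_iff_le_add, div_le_iff₀ hDpos]
      have h4 := mul_le_mul_of_nonneg_left h3 (Real.exp_pos (-k i)).le
      have e1 : Real.exp (-k i) * Real.exp (p i (-1) + k i) = Real.exp (p i (-1)) := by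
        rw [← Real.exp_add]; ring_nf
      have e2 : Real.exp (-k i) * Real.exp (p i 0 + k i) = Real.exp (p i 0) := by
        rw [← Real.exp_add]; ring_nf
      have e3 : Real.exp (-k i) * Real.exp (-(m i 0 + k i)) =
          Real.exp (-(2 * k i)) * Real.exp (-m i 0) := by
        rw [← Real.exp_add, ← Real.exp_add]; ring_nf
      rw [e1] at h4
      refine h4.trans_eq ?_
      linear_combination D i * Real.exp (-1) * e2 + D i * 2 * Real.sinh 1 * e3
    have hexp : ∀ {u : ι → ℝ} {a : ℝ}, Tendsto u l (𝓝 a) →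
        Tendsto (fun i => Real.exp (u i)) l (𝓝 (Real.exp a)) := fun hu =>
      (Real.continuous_exp.tendsto _).comp hu
    have hlow : Tendsto (fun i => (Real.exp (p i (-1)) / D i - Real.exp (-1) * Real.exp (p i 0)) /
        (2 * Real.sinh 1 * Real.exp (-m i 0))) l (𝓝 1) := by
      have h1 := (((hexp (hpt (-1))).div hDt one_ne_zero).sub
        ((hexp (hpt 0)).const_mul (Real.exp (-1)))).div
        ((hexp (hmt 0).neg).const_mul (2 * Real.sinh 1)) (by positivity)
      have h2 : (Real.exp (- -1) / 1 - Real.exp (-1) * Real.exp (-0)) /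
          (2 * Real.sinh 1 * Real.exp (-0)) = 1 := by
        rw [neg_neg, div_one, neg_zero, Real.exp_zero, mul_one, mul_one,
          div_eq_iff (by positivity), one_mul, Real.sinh_eq]
        ring
      rwa [h2] at h1
    have h2 : Tendsto (fun i => Real.exp (-(2 * k i))) l (𝓝 1) :=
      tendsto_of_tendsto_of_tendsto_of_le_of_le hlow tendsto_const_nhds hkey fun i =>
        Real.exp_le_one_iff.mpr (by linarith [hk0 i])
    have h3 := (h2.log one_ne_zero).div_const (-2)
    simp only [Real.log_exp, Real.log_one, zero_div] at h3
    exact h3.congr fun i => by ring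
  refine tendsto_subtype_rng.mpr (tendsto_continuousMap_of_lipschitz
    (fun i y z => ((F i).2.dist_eq y z).le) fun t => ?_)
  rw [tendsto_iff_dist_tendsto_zero]
  -- As p → -t, m → t and k → 0 at time t, the bound on cosh of the distance from `g t` to the point
  -- of `F i` at time t tends to 1.
  obtain ⟨C, hC⟩ : ∃ C : ι → ℝ, C = fun i => (Real.exp (p i t + k i + t) +
    Real.exp (m i t + k i - t)) / 2 := ⟨_, rfl⟩
  have hCt : Tendsto C l (𝓝 1) := by
    have h1 : Tendsto (fun i => Real.exp (p i t + k i + t)) l (𝓝 (Real.exp (-t + 0 + t))) :=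
      (Real.continuous_exp.tendsto _).comp (((hpt t).add hkt).add_const t)
    have h2 : Tendsto (fun i => Real.exp (m i t + k i - t)) l (𝓝 (Real.exp (t + 0 - t))) :=
      (Real.continuous_exp.tendsto _).comp (((hmt t).add hkt).sub_const t)
    rw [hC]
    simpa using (h1.add h2).div_const 2
  refine squeeze_zero (fun i => dist_nonneg) (fun i => ?_)
    (show Tendsto (fun i => Real.sqrt (C i ^ 2 - 1)) l (𝓝 0) by
      simpa using ((hCt.pow 2).sub_const 1).sqrt)
  have h1 := hX.cosh_dist_geodesic_le (F i) (g.1 t) t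
  rw [hp', hm', dist_comm] at h1
  exact (Real.self_le_sinh_iff.mpr dist_nonneg).trans
    (sinh_le_sqrt_of_cosh_le (h1.trans_eq (by rw [hC])))

theorem IsCATNegOne.continuous_boundaryPoint [ProperSpace X] (hX : IsCATNegOne X) :
    Continuous (Geodesic.boundaryPoint : Geodesic X → CStar (X × X)) := by
  refine (continuous_cls _).comp (continuous_iff_continuousAt.mpr fun g =>
    tendsto_continuousMap_of_lipschitz (fun g' => dist_maxBusemann_le _ _) fun z => ?_)
  have h : ∀ t : ℝ, Tendsto (fun g' : Geodesic X => g'.1 t) (𝓝 g) (𝓝 (g.1 t)) := fun t =>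
    ((continuous_eval_const t).comp continuous_subtype_val).tendsto g
  exact (hX.tendsto_busemannFun_of_tendsto (fun t => h t) z.1).max
    (hX.tendsto_busemannFun_of_tendsto (fun t => h (-t)) z.2)

theorem IsCATNegOne.boundaryPoint_injective [ProperSpace X] (hX : IsCATNegOne X) :
    Function.Injective (Geodesic.boundaryPoint : Geodesic X → CStar (X × X)) := by
  intro g g' h
  have : Tendsto (fun _ : ℕ => g) atTop (𝓝 g') :=
    hX.tendsto_of_tendsto_boundaryPoint (by rw [h]; exact tendsto_const_nhds)
  exact tendsto_nhds_unique tendsto_const_nhds this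

/-- The homeomorphism from geodesics to the ideal domain. -/
noncomputable def IsCATNegOne.boundaryHomeomorph [ProperSpace X] (hX : IsCATNegOne X) :
    Geodesic X ≃ₜ idealDomain X :=
  (Equiv.ofBijective (fun g : Geodesic X => (⟨g.boundaryPoint, g.boundaryPoint_mem⟩ : idealDomain X))
    ⟨fun _ _ h => hX.boundaryPoint_injective (congrArg Subtype.val h), fun F => by
      obtain ⟨g, hg⟩ := hX.exists_boundaryPoint_eq F.2
      exact ⟨g, Subtype.ext hg⟩⟩).toHomeomorphOfIsInducing (by
    refine IsInducing.subtypeVal.of_comp_iff.mp (isInducing_iff_nhds.mpr fun g => le_antisymm ?_ ?_)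
    · exact (hX.continuous_boundaryPoint.tendsto g).le_comap
    -- The convergence statement holds for arbitrary filters; for the identity along the pulled-back
    -- neighbourhood filter it is the remaining half of being inducing.
    · exact hX.tendsto_of_tendsto_boundaryPoint (F := id) tendsto_comap)

end EndMap

end MaxHoro

theorem mainTheorem2 (X : Type*) [MetricSpace X] [ProperSpace X] [NoncompactSpace X]
    (hX : MaxHoro.IsCATNegOne X) (Γ : Subgroup (X ≃ᵢ X))
    (hpd : MaxHoro.IsProperlyDiscontinuous Γ) (hcc : MaxHoro.IsCocompact Γ) :
    (∀ γ ∈ Γ, ∀ F ∈ MaxHoro.idealDomain X,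
      MaxHoro.act (MaxHoro.diag γ) F ∈ MaxHoro.idealDomain X) ∧
    ∃ f : MaxHoro.Geodesic X ≃ₜ MaxHoro.idealDomain X,
      (∀ g : MaxHoro.Geodesic X,
        Tendsto (fun n : ℕ => MaxHoro.iota (g.1 (n : ℝ), g.1 (-(n : ℝ)))) atTop
          (𝓝 (f g : MaxHoro.CStar (X × X)))) ∧
      ∀ γ ∈ Γ, ∀ g : MaxHoro.Geodesic X,
        (f (MaxHoro.Geodesic.translate γ g) : MaxHoro.CStar (X × X)) =
          MaxHoro.act (MaxHoro.diag γ) (f g) := by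
  refine ⟨fun γ _ F hF => ?_, hX.boundaryHomeomorph, fun g => g.tendsto_iota,
    fun γ _ g => MaxHoro.boundaryPoint_translate γ g⟩
  obtain ⟨g, rfl⟩ := hX.exists_boundaryPoint_eq hF
  rw [← MaxHoro.boundaryPoint_translate]
  exact MaxHoro.Geodesic.boundaryPoint_mem _
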